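/- **Definitions.** All graphs are finite, simple and have at least one vertex. For a vertex $v$, $N[v]$ denotes its closed neighborhood. A *legal dominating sequence* of a graph $G$ is a sequence $(v_1,\dots,v_k)$ of distinct vertices such that $\{v_1,\dots,v_k\}$ is a dominating set of $G$ and $N[v_i]\setminus\bigcup_{j<i}N[v_j]\neq\emptyset$ for every $i$. A *Grundy dominating sequence* is a legal dominating sequence of maximum length; this length is the Grundy domination number $\gamma_{gr}(G)$. For a graph $G$ and a family $\mathcal R=\{G_v : v\in V(G)\}$ of graphs, $G\hookleftarrow\mathcal R$ is the graph obtained by replacing every vertex $v$ of $G$ by $G_v$: its vertex set is the disjoint union of the sets $V(G_v)$, each $G_v$ keeps its edges, and for $u\ne v$ every vertex of $G_u$ is adjacent to every vertex of $G_v$ if $uv\in E(G)$, and to none of them otherwise. $P_n^m$ is the $m$-th power of the path $P_n$ with vertex set $[n]=\{1,\dots,n\}$ and edges $\{i,i+1\}$: distinct vertices are adjacent in $P_n^m$ iff their distance in $P_n$ is at most $m$. Let $m\ge 1$ and $n\ge m+2$ be integers. Let $\tilde{\mathcal I}$ be the family of non-empty independent sets $I$ of $P_n^m$ with $\min I\le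 m+1$ and $\max I\ge n-m$. For $I=\{i^1<i^2<\dots<i^p\}\in\tilde{\mathcal I}$ let $S_P(I)$ be the sequence of vertices of $P_n^m$ that is the concatenation, for $j=1,\dots,p-1$ in this order, of the sequences $(i^j,\,i^j+1,\,\dots,\,i^{j+1}-(m+1))$, followed by $(i^p)$. **Theorem.** Let $G=P_n^m$ with $m\geq 1$ and $m+2\le n$, and let $\mathcal R=\{G_i : i\in[n]\}$ be a family of graphs. Then $$\gamma_{gr}(G\hookleftarrow\mathcal R)=\max_{I\in\tilde{\mathcal I}}\Big\{\sum_{i\in I}(\gamma_{gr}(G_i)-1)+\max I-\min I-|I|\,m\Big\}+m+1 .$$ Moreover, let $S_i$ be a Grundy dominating sequence of $G_i$ for every $i\in[n]$, let $w_i$ be any vertex of $G_i$ for every $i\in[n]$, and let $I^*\in\tilde{\mathcal I}$ be such that $$\sum_{i\in I^*}(\gamma_{gr}(G_i)-1)+\max I^*-\min I^*-|I^*|\,m+m+1=\gamma_{gr}(G\hookleftarrow\mathcal R).$$ Then the sequence obtained from $S_P(I^*)$ by replacing each $i\in I^*$ by the sequence $S_i$, and each other vertex $i$ occurring in it by the single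 vertex $w_i$, is a Grundy dominating sequence of $G\hookleftarrow\mathcal R$. -/

import Mathlib

namespace GrundyXJoin

/-- The `m`-th power of `G`: distinct vertices are adjacent iff their distance in `G` is at most
`m` (the extended distance is used, so vertices in different components are never adjacent). -/
def graphPower {V : Type*} (G : SimpleGraph V) (m : ℕ) : SimpleGraph V where
  Adj u v := u ≠ v ∧ G.edist u v ≤ (m : ℕ∞)
  symm := ⟨fun u v h => ⟨h.1.symm, by rw [SimpleGraph.edist_comm]; exact h.2⟩⟩
  loopless := ⟨fun _ h => h.1 rfl⟩

/-- The power of a path `P_n^m`. The vertex carrying the label `i ∈ {1, …, n}` is the element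
`i - 1` of `Fin n`, see `label`. -/
def pathPower (n m : ℕ) : SimpleGraph (Fin n) :=
  graphPower (SimpleGraph.pathGraph n) m

/-- The label in `{1, …, n}` of a vertex of the path on `n` vertices. -/
def label {n : ℕ} (i : Fin n) : ℕ := (i : ℕ) + 1

/-- The `X`-join of `G` and the family `H`: every vertex `i` of `G` is replaced by `H i`. -/
def xJoin {ι : Type*} (G : SimpleGraph ι) {V : ι → Type*} (H : ∀ i, SimpleGraph (V i)) :
    SimpleGraph (Σ i, V i) where
  Adj x y := G.Adj x.1 y.1 ∨
    ∃ (i : ι) (a b : V i), x = ⟨i, a⟩ ∧ y = ⟨i, b⟩ ∧ (H i).Adj a b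
  symm := ⟨by
    rintro x y (h | ⟨i, a, b, hx, hy, h⟩)
    · exact Or.inl h.symm
    · exact Or.inr ⟨i, b, a, hy, hx, h.symm⟩⟩
  loopless := ⟨by
    rintro x (h | ⟨i, a, b, hx, hy, h⟩)
    · exact G.irrefl h
    · subst hx
      cases hy
      exact (H i).irrefl h⟩

/-- The closed neighborhood `N[v]`. -/
def closedNbhd {V : Type*} (G : SimpleGraph V) (v : V) : Set V := insert v (G.neighborSet v)

/-- The private neighborhood of the `k`-th entry of `S` (counted from `0`) with respect to `S`:
its closed neighborhood minus the closed neighborhoods of all earlier entries. -/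
def privateNbhd {V : Type*} (G : SimpleGraph V) (S : List V) (k : Fin S.length) : Set V :=
  closedNbhd G (S.get k) \ ⋃ j : Fin S.length, ⋃ _ : j < k, closedNbhd G (S.get j)

/-- Dominating sets. -/
def IsDominating {V : Type*} (G : SimpleGraph V) (D : Set V) : Prop :=
  ∀ v, (D ∩ closedNbhd G v).Nonempty

/-- Legal dominating sequences. -/
structure IsLegal {V : Type*} (G : SimpleGraph V) (S : List V) : Prop where
  nodup : S.Nodup
  dominating : IsDominating G {v | v ∈ S}
  private_nonempty : ∀ k : Fin S.length, (privateNbhd G S k).Nonempty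

/-- Grundy dominating sequences: legal dominating sequences of maximum length. -/
def IsGds {V : Type*} (G : SimpleGraph V) (S : List V) : Prop :=
  IsLegal G S ∧ ∀ T : List V, IsLegal G T → T.length ≤ S.length

/-- The Grundy domination number: the maximum length of a legal dominating sequence (used for
finite graphs, where the lengths form a nonempty set bounded by the number of vertices). -/
noncomputable def grundyNumber {V : Type*} (G : SimpleGraph V) : ℕ :=
  sSup {k | ∃ S : List V, IsLegal G S ∧ S.length = k}

/-- A (nonempty) independent set `I` of `P_n^m` with `min I ≤ m + 1` and `max I ≥ n - m`. -/
def Admissible (n m : ℕ) (I : Finset (Fin n)) (hI : I.Nonempty) : Prop :=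
  (pathPower n m).IsIndepSet (I : Set (Fin n)) ∧
    label (I.min' hI) ≤ m + 1 ∧ n - m ≤ label (I.max' hI)

/-- The quantity `∑ i ∈ I, (γ_gr(G_i) - 1) + max I - min I - |I| m`. -/
noncomputable def objective {n : ℕ} (m : ℕ) {V : Fin n → Type*} (H : ∀ i, SimpleGraph (V i))
    (I : Finset (Fin n)) (hI : I.Nonempty) : ℤ :=
  ∑ i ∈ I, ((grundyNumber (H i) : ℤ) - 1) + (label (I.max' hI) : ℤ) - (label (I.min' hI) : ℤ)
    - (I.card : ℤ) * (m : ℤ)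

/-- The sequence `S(a, b)` of the vertices with labels `a, a + 1, …, b`, in increasing order. -/
def interval (n a b : ℕ) : List (Fin n) :=
  (List.finRange n).filter fun k => a ≤ label k ∧ label k ≤ b

/-- For a list `i¹, …, iᵖ` of vertices, the concatenation of the sequences
`S(iʲ, iʲ⁺¹ - (m + 1))` for `1 ≤ j < p`, followed by `iᵖ`. -/
def pathSeqAux {n : ℕ} (m : ℕ) : List (Fin n) → List (Fin n)
  | [] => []
  | [i] => [i]
  | i :: j :: l => interval n (label i) (label j - (m + 1)) ++ pathSeqAux m (j :: l)

/-- The sequence `S_P(I)`, built from the elements of `I` in increasing order. -/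
def pathSeq {n : ℕ} (m : ℕ) (I : Finset (Fin n)) : List (Fin n) :=
  pathSeqAux m (I.sort (· ≤ ·))

/-- The sequence of vertices of the `X`-join obtained from a sequence `T` of vertices of the main
factor by replacing each `i ∈ I` by the sequence `S i` of vertices of the `i`-th graph, and each
`i ∉ I` by the single vertex `w i` of the `i`-th graph. -/
def substSeq {n : ℕ} {V : Fin n → Type*} (I : Finset (Fin n)) (S : ∀ i, List (V i))
    (w : ∀ i, V i) (T : List (Fin n)) : List (Σ i, V i) :=
  T.flatMap fun i => (if i ∈ I then S i else [w i]).map fun a => ⟨i, a⟩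

end GrundyXJoin

/-! Lower bound: in `pathSeq m I` no entry lies in the `m` places before an element `i` of `I`, so
the fibre over `i` is undominated when its turn comes and can absorb a whole Grundy sequence of `H
i`. Every other entry `k` footprints the fibre over `k + m`. The length of the substituted sequence
is the objective plus `m + 1` (`isLegal_substSeq`, `length_substSeq`).

Upper bound: give each entry of a legal sequence a footprint, chosen over the same path vertex as
the entry whenever possible. Let `F` be the set of path vertices carrying footprints and `B ⊆ F`
those footprinted at least once from their own fibre. Then `B` is independent. A fibre over `i ∈ B`
carries at most `grundyNumber (H i)` footprints, and one over `F \ B` only one, since an entry over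
a neighbour dominates the whole fibre. So the length is at most `|F| + ∑ i ∈ B, (grundyNumber (H i)
- 1)`.

It remains to bound `|F|`. Between two vertices each in `B` or an end of the path, the first
footprint made there costs `m` vertices that are never footprinted (`card_window_le`). Adding up
these windows, with ends of the path joined to `B` where needed, gives an admissible `I ⊇ B` with
the required bound (`exists_admissible_card_le`). -/

namespace GrundyXJoin

/-! ### Sequences with footprints and the Grundy number -/

/-- Every entry of `S` has a closed neighbor outside the closed neighborhoods of the earlier
entries. -/
def HasFootprints {V : Type*} (G : SimpleGraph V) (S : List V) : Prop :=
  ∀ l₁ x l₂, S = l₁ ++ x :: l₂ → ∃ y ∈ closedNbhd G x, ∀ z ∈ l₁, y ∉ closedNbhd G z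

theorem mem_closedNbhd {V : Type*} {G : SimpleGraph V} {u v : V} :
    u ∈ closedNbhd G v ↔ u = v ∨ G.Adj v u := Iff.rfl

theorem self_mem_closedNbhd {V : Type*} (G : SimpleGraph V) (v : V) : v ∈ closedNbhd G v :=
  Or.inl rfl

theorem mem_closedNbhd_comm {V : Type*} {G : SimpleGraph V} {u v : V} :
    u ∈ closedNbhd G v ↔ v ∈ closedNbhd G u := by
  rw [mem_closedNbhd, mem_closedNbhd, eq_comm, G.adj_comm]

theorem privateNbhd_nonempty_iff {V : Type*} {G : SimpleGraph V} {S : List V}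
    (k : Fin S.length) : (privateNbhd G S k).Nonempty ↔
      ∃ y ∈ closedNbhd G (S.get k), ∀ j < k, y ∉ closedNbhd G (S.get j) := by
  simp [privateNbhd, Set.Nonempty]

theorem hasFootprints_iff {V : Type*} {G : SimpleGraph V} {S : List V} :
    HasFootprints G S ↔ ∀ k : Fin S.length, (privateNbhd G S k).Nonempty := by
  simp only [privateNbhd_nonempty_iff]
  constructor
  · intro h k
    obtain ⟨y, hy, hz⟩ := h (S.take k) (S.get k) (S.drop (k + 1)) (by simp)
    refine ⟨y, hy, fun j hj => hz _ ?_⟩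
    rw [List.mem_take_iff_getElem]
    exact ⟨j, by simpa using hj, rfl⟩
  · rintro h l₁ x l₂ rfl
    obtain ⟨y, hy, hz⟩ := h ⟨l₁.length, by simp⟩
    refine ⟨y, by simpa using hy, fun z hzl => ?_⟩
    obtain ⟨j, hj, rfl⟩ := List.getElem_of_mem hzl
    have := hz ⟨j, by simp; omega⟩ (by simpa using hj)
    simpa [List.getElem_append_left hj] using this

theorem HasFootprints.nodup {V : Type*} {G : SimpleGraph V} {S : List V}
    (h : HasFootprints G S) : S.Nodup := by
  induction S using List.reverseRecOn with
  | nil => simp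
  | append_singleton l x ih =>
    have hl : HasFootprints G l := by
      rintro l₁ z l₂ rfl
      exact h l₁ z (l₂ ++ [x]) (by simp)
    obtain ⟨y, hy, hz⟩ := h l x [] rfl
    refine List.nodup_append.2 ⟨ih hl, by simp, ?_⟩
    rintro a ha b hb rfl
    rw [List.mem_singleton.1 hb] at ha
    exact hz x ha hy

theorem HasFootprints.concat {V : Type*} {G : SimpleGraph V} {S : List V}
    (h : HasFootprints G S) {v : V} (hv : ∀ z ∈ S, v ∉ closedNbhd G z) :
    HasFootprints G (S ++ [v]) := by
  intro l₁ x l₂ e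
  rcases List.eq_nil_or_concat l₂ with rfl | ⟨l₃, u, rfl⟩
  · obtain ⟨rfl, e'⟩ := List.append_inj' e rfl
    obtain rfl : v = x := by simpa using e'
    exact ⟨v, self_mem_closedNbhd G v, hv⟩
  · have e' : S ++ [v] = (l₁ ++ x :: l₃) ++ [u] := by simpa using e
    exact h l₁ x l₃ (List.append_inj' e' rfl).1

/-- Domination comes for free: an undominated vertex can be appended as its own footprint, and
finiteness stops the process. Hence only footprints matter for lower bounds on `grundyNumber`. -/
theorem HasFootprints.exists_isLegal {V : Type*} [Finite V] {G : SimpleGraph V} {S : List V}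
    (h : HasFootprints G S) : ∃ T, IsLegal G T ∧ S.length ≤ T.length := by
  have := Fintype.ofFinite V
  induction hk : Fintype.card V - S.length using Nat.strong_induction_on generalizing S with
  | _ k ih =>
    by_cases hd : IsDominating G {v | v ∈ S}
    · exact ⟨S, ⟨h.nodup, hd, hasFootprints_iff.1 h⟩, le_rfl⟩
    · simp only [IsDominating, not_forall, Set.not_nonempty_iff_eq_empty] at hd
      obtain ⟨v, hv⟩ := hd
      have hS := h.concat (v := v) fun z hz hvz => by
        have : z ∈ ({v | v ∈ S} ∩ closedNbhd G v : Set V) := ⟨hz, mem_closedNbhd_comm.1 hvz⟩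
        simp [hv] at this
      have hc := hS.nodup.length_le_card
      rw [List.length_append, List.length_singleton] at hc
      obtain ⟨T, hT, hl⟩ := ih _ (by rw [← hk, List.length_append, List.length_singleton]; omega)
        hS rfl
      exact ⟨T, hT, le_trans (by simp) hl⟩

theorem IsLegal.hasFootprints {V : Type*} {G : SimpleGraph V} {S : List V}
    (h : IsLegal G S) : HasFootprints G S := hasFootprints_iff.2 h.private_nonempty

theorem bddAbove_length_isLegal {V : Type*} [Finite V] (G : SimpleGraph V) :
    BddAbove {k | ∃ S : List V, IsLegal G S ∧ S.length = k} := by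
  have := Fintype.ofFinite V
  refine ⟨Fintype.card V, ?_⟩
  rintro k ⟨S, hS, rfl⟩
  exact hS.nodup.length_le_card

theorem IsLegal.length_le_grundyNumber {V : Type*} [Finite V] {G : SimpleGraph V} {S : List V}
    (h : IsLegal G S) : S.length ≤ grundyNumber G :=
  le_csSup (bddAbove_length_isLegal G) ⟨S, h, rfl⟩

theorem HasFootprints.length_le_grundyNumber {V : Type*} [Finite V] {G : SimpleGraph V}
    {S : List V} (h : HasFootprints G S) : S.length ≤ grundyNumber G := by
  obtain ⟨T, hT, hl⟩ := h.exists_isLegal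
  exact hl.trans hT.length_le_grundyNumber

theorem exists_isLegal_length_eq {V : Type*} [Finite V] (G : SimpleGraph V) :
    ∃ S : List V, IsLegal G S ∧ S.length = grundyNumber G := by
  refine Nat.sSup_mem ?_ (bddAbove_length_isLegal G)
  obtain ⟨T, hT, -⟩ := HasFootprints.exists_isLegal (G := G) (S := []) (by simp [HasFootprints])
  exact ⟨_, T, hT, rfl⟩

theorem isGds_iff {V : Type*} [Finite V] {G : SimpleGraph V} {S : List V} :
    IsGds G S ↔ IsLegal G S ∧ S.length = grundyNumber G := by
  constructor
  · rintro ⟨h, hm⟩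
    obtain ⟨T, hT, hl⟩ := exists_isLegal_length_eq G
    exact ⟨h, le_antisymm h.length_le_grundyNumber (hl ▸ hm T hT)⟩
  · rintro ⟨h, hl⟩
    exact ⟨h, fun T hT => hl ▸ hT.length_le_grundyNumber⟩

theorem card_le_grundyNumber {V ι : Type*} [Finite V] [LinearOrder ι] {G : SimpleGraph V}
    (s : Finset ι) (x y : ι → V) (hxy : ∀ p ∈ s, y p ∈ closedNbhd G (x p))
    (hlt : ∀ p ∈ s, ∀ q ∈ s, p < q → y q ∉ closedNbhd G (x p)) :
    s.card ≤ grundyNumber G := by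
  have h : HasFootprints G ((s.sort (· ≤ ·)).map x) := by
    intro l₁ a l₂ e
    obtain ⟨r₁, r, hr, rfl, hr'⟩ := List.map_eq_append_iff.1 e
    obtain ⟨q, r₂, rfl, rfl, rfl⟩ := List.map_eq_cons_iff.1 hr'
    have hs : (s.sort (· ≤ ·)).Pairwise (· < ·) := s.sortedLT_sort.pairwise
    have hmem : ∀ p, p ∈ s.sort (· ≤ ·) ↔ p ∈ s := fun p => s.mem_sort _
    rw [hr] at hs hmem
    refine ⟨y q, hxy q ((hmem q).1 (by simp)), fun z hz => ?_⟩
    obtain ⟨p, hp, rfl⟩ := List.mem_map.1 hz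
    exact hlt p ((hmem p).1 (by simp [hp])) q ((hmem q).1 (by simp))
      ((List.pairwise_append.1 hs).2.2 p hp q (by simp))
  simpa using h.length_le_grundyNumber

theorem one_le_grundyNumber {V : Type*} [Finite V] [Nonempty V] (G : SimpleGraph V) :
    1 ≤ grundyNumber G := by
  obtain ⟨v⟩ := ‹Nonempty V›
  simpa using card_le_grundyNumber (G := G) {()} (fun _ => v) (fun _ => v)
    (fun _ _ => self_mem_closedNbhd G v) (fun _ _ _ _ h => absurd h (lt_irrefl _))

/-! ### Adjacency in X-joins and in path powers -/

theorem mem_closedNbhd_xJoin {ι : Type*} {G : SimpleGraph ι} {V : ι → Type*}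
    {H : ∀ i, SimpleGraph (V i)} {i j : ι} {a : V i} {b : V j} :
    (⟨j, b⟩ : Σ i, V i) ∈ closedNbhd (xJoin G H) ⟨i, a⟩ ↔
      G.Adj i j ∨ ∃ h : j = i, h ▸ b ∈ closedNbhd (H i) a := by
  rw [mem_closedNbhd]
  constructor
  · rintro (h | h | ⟨k, a', b', h₁, h₂, h⟩)
    · cases h
      exact Or.inr ⟨rfl, Or.inl rfl⟩
    · exact Or.inl h
    · cases h₁
      cases h₂
      exact Or.inr ⟨rfl, Or.inr h⟩
  · rintro (h | ⟨rfl, h | h⟩)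
    · exact Or.inr (Or.inl h)
    · cases h
      exact Or.inl rfl
    · exact Or.inr (Or.inr ⟨j, a, b, rfl, rfl, h⟩)

theorem exists_walk_pathGraph_length {n : ℕ} {i j : Fin n} (h : i ≤ j) :
    ∃ w : (SimpleGraph.pathGraph n).Walk i j, w.length = (j : ℕ) - i := by
  obtain ⟨j, hj⟩ := j
  induction j with
  | zero =>
    obtain rfl : i = ⟨0, hj⟩ := Fin.le_antisymm h (Fin.mk_le_of_le_val (Nat.zero_le _))
    exact ⟨.nil, by simp⟩
  | succ j ih =>
    rcases h.eq_or_lt with rfl | h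
    · exact ⟨.nil, by simp⟩
    · have hij : i ≤ ⟨j, by omega⟩ := Nat.lt_succ_iff.1 h
      obtain ⟨w, hw⟩ := ih (by omega) hij
      have hij' : (i : ℕ) ≤ j := hij
      refine ⟨w.concat (SimpleGraph.pathGraph_adj.2 (Or.inl rfl)), ?_⟩
      simp [hw]
      omega

theorem le_length_walk_pathGraph {n : ℕ} {i j : Fin n} (w : (SimpleGraph.pathGraph n).Walk i j) :
    (j : ℕ) ≤ i + w.length ∧ (i : ℕ) ≤ j + w.length := by
  induction w with
  | nil => simp
  | cons h w ih =>
    have := SimpleGraph.pathGraph_adj.1 h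
    simp only [SimpleGraph.Walk.length_cons]
    omega

theorem pathPower_adj {n m : ℕ} {i j : Fin n} :
    (pathPower n m).Adj i j ↔ i ≠ j ∧ (j : ℕ) ≤ i + m ∧ (i : ℕ) ≤ j + m := by
  refine and_congr_right fun _ => ⟨fun h => ?_, fun h => ?_⟩
  · obtain ⟨w, hw⟩ := SimpleGraph.exists_walk_of_edist_ne_top
      (ne_top_of_le_ne_top (ENat.natCast_ne_top m) h)
    rw [← hw, Nat.cast_le] at h
    have := le_length_walk_pathGraph w
    omega
  · rcases le_total i j with hij | hij
    · obtain ⟨w, hw⟩ := exists_walk_pathGraph_length hij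
      refine w.edist_le.trans (Nat.cast_le.2 ?_)
      omega
    · obtain ⟨w, hw⟩ := exists_walk_pathGraph_length hij
      rw [SimpleGraph.edist_comm]
      refine w.edist_le.trans (Nat.cast_le.2 ?_)
      omega

/-! ### The sequence `pathSeq m I` on the path -/

theorem mem_interval {n a b : ℕ} {k : Fin n} :
    k ∈ interval n a b ↔ a ≤ label k ∧ label k ≤ b := by
  simp [interval]

theorem pairwise_lt_interval (n a b : ℕ) : (interval n a b).Pairwise (· < ·) :=
  (List.pairwise_lt_finRange n).filter _

theorem length_interval {n m : ℕ} {i j : Fin n} (h : (i : ℕ) + m < j) :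
    ((interval n (label i) (label j - (m + 1))).length : ℤ) = (j : ℤ) - i - m := by
  have e : interval n (label i) (label j - (m + 1)) =
      (Finset.Icc i ⟨j - (m + 1), by omega⟩).sort (· ≤ ·) := by
    refine List.Perm.eq_of_pairwise (le := (· < ·)) (fun a b _ _ h₁ h₂ => absurd h₁ h₂.asymm)
      (pairwise_lt_interval _ _ _) (Finset.sortedLT_sort _).pairwise ?_
    refine (List.perm_ext_iff_of_nodup (pairwise_lt_interval _ _ _).nodup
      (Finset.sort_nodup _ _)).2 fun k => ?_
    simp only [mem_interval, label, Finset.mem_sort, Finset.mem_Icc, Fin.le_def]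
    omega
  rw [e, Finset.length_sort, Fin.card_Icc]
  simp only
  omega

theorem mem_pathSeqAux_head {n m : ℕ} (i : Fin n) (l : List (Fin n))
    (hl : (i :: l).Pairwise fun a b : Fin n => (a : ℕ) + m < b) : i ∈ pathSeqAux m (i :: l) := by
  cases l with
  | nil => simp [pathSeqAux]
  | cons j l =>
    have := (List.pairwise_cons.1 hl).1 j (by simp)
    simp only [pathSeqAux, List.mem_append, mem_interval, label]
    left
    omega

theorem head_le_of_mem_pathSeqAux {n m : ℕ} (i : Fin n) (l : List (Fin n))
    (hl : (i :: l).Pairwise fun a b : Fin n => (a : ℕ) + m < b) :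
    ∀ k ∈ pathSeqAux m (i :: l), i ≤ k := by
  induction l generalizing i with
  | nil => simp [pathSeqAux]
  | cons j l ih =>
    intro k hk
    have hij := (List.pairwise_cons.1 hl).1 j (by simp)
    simp only [pathSeqAux, List.mem_append, mem_interval, label] at hk
    rcases hk with hk | hk
    · exact Fin.le_def.2 (by omega)
    · have := Fin.le_def.1 (ih j (List.pairwise_cons.1 hl).2 k hk)
      exact Fin.le_def.2 (by omega)

theorem pairwise_lt_pathSeqAux {n m : ℕ} (l : List (Fin n))
    (hl : l.Pairwise fun a b : Fin n => (a : ℕ) + m < b) : (pathSeqAux m l).Pairwise (· < ·) := by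
  match l with
  | [] => simp [pathSeqAux]
  | [i] => simp [pathSeqAux]
  | i :: j :: l =>
    have hj := (List.pairwise_cons.1 hl).2
    have hij := (List.pairwise_cons.1 hl).1 j (by simp)
    refine List.pairwise_append.2 ⟨pairwise_lt_interval _ _ _, pairwise_lt_pathSeqAux _ hj, ?_⟩
    intro a ha b hb
    have hb' := Fin.le_def.1 (head_le_of_mem_pathSeqAux j l hj b hb)
    simp only [mem_interval, label] at ha
    exact Fin.lt_def.2 (by omega)

theorem subset_pathSeqAux {n m : ℕ} (l : List (Fin n))
    (hl : l.Pairwise fun a b : Fin n => (a : ℕ) + m < b) : ∀ k ∈ l, k ∈ pathSeqAux m l := by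
  match l with
  | [] => simp
  | [i] => simp [pathSeqAux]
  | i :: j :: l =>
    intro k hk
    rcases List.mem_cons.1 hk with rfl | hk
    · exact mem_pathSeqAux_head _ _ hl
    · exact List.mem_append_right _ (subset_pathSeqAux _ (List.pairwise_cons.1 hl).2 k hk)

/-- The block before `j` stops at `j - (m + 1)`, just out of reach of `j`. This keeps the fibres
over `I` undominated until they are visited. -/
theorem add_lt_of_mem_pathSeqAux {n m : ℕ} (l : List (Fin n))
    (hl : l.Pairwise fun a b : Fin n => (a : ℕ) + m < b) :
    ∀ i ∈ l, ∀ k ∈ pathSeqAux m l, k < i → (k : ℕ) + m < i := by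
  match l with
  | [] => simp
  | [i] => simp +contextual [pathSeqAux]
  | i :: j :: l =>
    have hj := (List.pairwise_cons.1 hl).2
    intro a ha k hk hka
    rcases List.mem_cons.1 ha with rfl | ha
    · exact absurd hka (head_le_of_mem_pathSeqAux _ _ hl k hk).not_gt
    · rcases List.mem_append.1 hk with hk | hk
      · have := Fin.le_def.1 (head_le_of_mem_pathSeqAux j l hj a (subset_pathSeqAux _ hj a ha))
        simp only [mem_interval, label] at hk
        omega
      · exact add_lt_of_mem_pathSeqAux _ hj a ha k hk hka

theorem exists_add_lt_of_mem_pathSeqAux {n m : ℕ} (l : List (Fin n))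
    (hl : l.Pairwise fun a b : Fin n => (a : ℕ) + m < b) :
    ∀ k ∈ pathSeqAux m l, k ∉ l → ∃ j ∈ l, (k : ℕ) + m < j := by
  match l with
  | [] => simp [pathSeqAux]
  | [i] => simp [pathSeqAux]
  | i :: j :: l =>
    have hj := (List.pairwise_cons.1 hl).2
    have hij := (List.pairwise_cons.1 hl).1 j (by simp)
    intro k hk hkl
    rcases List.mem_append.1 hk with hk | hk
    · simp only [mem_interval, label] at hk
      exact ⟨j, by simp, by omega⟩
    · obtain ⟨a, ha, h⟩ := exists_add_lt_of_mem_pathSeqAux _ hj k hk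
        (fun h => hkl (List.mem_cons_of_mem _ h))
      exact ⟨a, List.mem_cons_of_mem _ ha, h⟩

theorem exists_near_mem_pathSeqAux {n m : ℕ} (hm : 1 ≤ m) (l : List (Fin n))
    (hl : l.Pairwise fun a b : Fin n => (a : ℕ) + m < b) (v : Fin n) (h₁ : ∃ i ∈ l, i ≤ v)
    (h₂ : ∃ i ∈ l, v ≤ i) (hv : v ∉ l) :
    ∃ k ∈ pathSeqAux m l, k ≠ v ∧ (v : ℕ) ≤ k + m ∧ (k : ℕ) ≤ v + m := by
  match l with
  | [] => simp at h₁
  | [i] =>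
    simp only [List.mem_singleton, exists_eq_left] at h₁ h₂ hv
    exact absurd (le_antisymm h₂ h₁) hv
  | i :: j :: l =>
    have hj := (List.pairwise_cons.1 hl).2
    have hij := (List.pairwise_cons.1 hl).1 j (by simp)
    have hv' : v ∉ j :: l := fun h => hv (List.mem_cons_of_mem _ h)
    have hvi : (v : ℕ) ≠ i := fun h => hv (by simp [Fin.ext h])
    have hiv : (i : ℕ) ≤ v := by
      obtain ⟨a, ha, hav⟩ := h₁
      exact (head_le_of_mem_pathSeqAux _ _ hl a (subset_pathSeqAux _ hl a ha)).trans hav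
    rcases le_or_gt j v with hjv | hjv
    · obtain ⟨k, hk, h⟩ := exists_near_mem_pathSeqAux hm _ hj v ⟨j, by simp, hjv⟩ (by
        obtain ⟨a, ha, hva⟩ := h₂
        rcases List.mem_cons.1 ha with rfl | ha
        · exact absurd (le_antisymm hva hiv) (fun h => hvi (by rw [h]))
        · exact ⟨a, ha, hva⟩) hv'
      exact ⟨k, List.mem_append_right _ hk, h⟩
    · have hjv' := Fin.lt_def.1 hjv
      -- If `v - 1` is still in the block it is within `m` of `v` because `1 ≤ m`. Otherwise the
      -- last block vertex `j - (m + 1)` is within `m`, since `v < j`.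
      refine ⟨⟨min (v - 1) (j - (m + 1)), by omega⟩, List.mem_append_left _ ?_, ?_, ?_, ?_⟩
      · simp only [mem_interval, label]
        omega
      · simp only [ne_eq, Fin.ext_iff]
        omega
      · simp only
        omega
      · simp only
        omega

theorem length_pathSeqAux {n m : ℕ} (i : Fin n) (l : List (Fin n))
    (hl : (i :: l).Pairwise fun a b : Fin n => (a : ℕ) + m < b) :
    ((pathSeqAux m (i :: l)).length : ℤ) =
      (((i :: l).getLast (by simp) : Fin n) : ℤ) - i - l.length * m + 1 := by
  induction l generalizing i with
  | nil => simp [pathSeqAux]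
  | cons j l ih =>
    have hij := (List.pairwise_cons.1 hl).1 j (by simp)
    rw [pathSeqAux, List.length_append, Nat.cast_add, length_interval hij,
      ih j (List.pairwise_cons.1 hl).2, List.getLast_cons (a := i) (by simp : j :: l ≠ []), List.length_cons]
    push_cast
    ring

theorem isIndepSet_pathPower_iff {n m : ℕ} {I : Finset (Fin n)} :
    (pathPower n m).IsIndepSet (I : Set (Fin n)) ↔
      ∀ i ∈ I, ∀ j ∈ I, i < j → (i : ℕ) + m < j := by
  simp only [SimpleGraph.IsIndepSet, Set.Pairwise, Finset.mem_coe, pathPower_adj]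
  constructor
  · intro h i hi j hj hij
    have h₁ := h hi hj hij.ne
    have h₂ := Fin.lt_def.1 hij
    by_contra h₃
    exact h₁ ⟨hij.ne, by omega, by omega⟩
  · intro h i hi j hj hij
    rcases lt_or_gt_of_ne hij with h' | h'
    · have := h i hi j hj h'
      omega
    · have := h j hj i hi h'
      omega

theorem pairwise_sort_of_isIndepSet {n m : ℕ} {I : Finset (Fin n)}
    (h : (pathPower n m).IsIndepSet (I : Set (Fin n))) :
    (I.sort (· ≤ ·)).Pairwise fun a b : Fin n => (a : ℕ) + m < b := by
  refine (Finset.sortedLT_sort I).pairwise.imp_of_mem fun ha hb hab => ?_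
  exact isIndepSet_pathPower_iff.1 h _ ((I.mem_sort _).1 ha) _ ((I.mem_sort _).1 hb) hab

theorem length_pathSeq {n m : ℕ} {I : Finset (Fin n)} (hI : I.Nonempty)
    (h : (pathPower n m).IsIndepSet (I : Set (Fin n))) :
    ((pathSeq m I).length : ℤ) = (I.max' hI : ℤ) - (I.min' hI : ℤ) - I.card * m + m + 1 := by
  have hp := pairwise_sort_of_isIndepSet h
  have hmax : ∀ hne, I.max' hI = (I.sort (· ≤ ·)).getLast hne := fun hne => by
    rw [Finset.max'_eq_sorted_last, List.getLast_eq_getElem]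
  have hmin : ∀ hne, I.min' hI = (I.sort (· ≤ ·)).head hne := fun hne => by
    rw [Finset.min'_eq_sorted_zero, List.head_eq_getElem]
  have hlen := I.length_sort (· ≤ ·)
  rw [pathSeq]
  generalize I.sort (· ≤ ·) = l at *
  cases l with
  | nil => exact absurd hlen.symm hI.card_ne_zero
  | cons i l =>
    rw [length_pathSeqAux i l hp, hmax (by simp), hmin (by simp), ← hlen, List.length_cons,
      List.head_cons]
    push_cast
    ring

/-! ### Lower bound: substituting into `pathSeq m I` -/

theorem flatMap_eq_append_cons {α β : Type*} {f : α → List β} {T : List α} {l₁ l₂ : List β}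
    {x : β} (h : T.flatMap f = l₁ ++ x :: l₂) :
    ∃ T₁ i T₂ a₁ a₂, T = T₁ ++ i :: T₂ ∧ f i = a₁ ++ x :: a₂ ∧ l₁ = T₁.flatMap f ++ a₁ := by
  induction T generalizing l₁ with
  | nil => simp at h
  | cons t T ih =>
    rw [List.flatMap_cons, List.append_eq_append_iff] at h
    rcases h with ⟨r, rfl, h⟩ | ⟨r, h, h'⟩
    · obtain ⟨T₁, i, T₂, a₁, a₂, rfl, hi, rfl⟩ := ih h
      exact ⟨t :: T₁, i, T₂, a₁, a₂, rfl, hi, by simp⟩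
    · cases r with
      | nil =>
        obtain ⟨T₁, i, T₂, a₁, a₂, rfl, hi, e⟩ := ih (l₁ := []) h'.symm
        exact ⟨t :: T₁, i, T₂, a₁, a₂, rfl, hi, by
          rw [List.append_nil] at h
          rw [List.flatMap_cons, List.append_assoc, ← e, h, List.append_nil]⟩
      | cons y r =>
        obtain ⟨rfl, -⟩ := List.cons_eq_cons.1 h'
        exact ⟨[], t, T, l₁, r, rfl, h, rfl⟩

theorem exists_mem_add_eq {n m : ℕ} {k j : Fin n} (h : (k : ℕ) + m < j) :
    ∃ u : Fin n, (u : ℕ) = k + m :=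
  ⟨⟨k + m, by omega⟩, rfl⟩

theorem isLegal_substSeq {n m : ℕ} (hm : 1 ≤ m) {V : Fin n → Type*} [∀ i, Nonempty (V i)]
    {H : ∀ i, SimpleGraph (V i)} {S : ∀ i, List (V i)} (hS : ∀ i, IsLegal (H i) (S i))
    (w : ∀ i, V i) {I : Finset (Fin n)} (hI : I.Nonempty) (hadm : Admissible n m I hI) :
    IsLegal (xJoin (pathPower n m) H) (substSeq I S w (pathSeq m I)) := by
  obtain ⟨hind, hlo, hhi⟩ := hadm
  have hp := pairwise_sort_of_isIndepSet hind
  have hsort := pairwise_lt_pathSeqAux _ hp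
  have hlt := add_lt_of_mem_pathSeqAux _ hp
  have hex := exists_add_lt_of_mem_pathSeqAux _ hp
  have hsub := subset_pathSeqAux _ hp
  have hnear := exists_near_mem_pathSeqAux hm _ hp
  simp only [Finset.mem_sort] at hlt hex hsub hnear
  have hfoot : HasFootprints (xJoin (pathPower n m) H) (substSeq I S w (pathSeq m I)) := by
    intro l₁ x l₂ e
    obtain ⟨T₁, k, T₂, a₁, a₂, hT, hk, rfl⟩ := flatMap_eq_append_cons e
    change pathSeqAux m (I.sort (· ≤ ·)) = _ at hT
    rw [hT] at hsort hlt hex hsub hnear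
    have hT₁ : ∀ t ∈ T₁, t < k := fun t ht => (List.pairwise_append.1 hsort).2.2 t ht k (by simp)
    obtain ⟨b₁, r, hr, rfl, hr'⟩ := List.map_eq_append_iff.1 hk
    obtain ⟨b, b₂, rfl, rfl, rfl⟩ := List.map_eq_cons_iff.1 hr'
    by_cases hkI : k ∈ I
    · rw [if_pos hkI] at hr
      obtain ⟨y, hy, hyz⟩ := (hS k).hasFootprints b₁ b b₂ hr
      refine ⟨⟨k, y⟩, mem_closedNbhd_xJoin.2 (Or.inr ⟨rfl, hy⟩), fun z hz hyz' => ?_⟩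
      rcases List.mem_append.1 hz with hz | hz
      · obtain ⟨t, ht, hz⟩ := List.mem_flatMap.1 hz
        obtain ⟨c, -, rfl⟩ := List.mem_map.1 hz
        have h₁ := hlt k hkI t (by simp [ht]) (hT₁ t ht)
        rcases mem_closedNbhd_xJoin.1 hyz' with h | ⟨h, -⟩
        · have := pathPower_adj.1 h
          omega
        · rw [h] at h₁
          omega
      · obtain ⟨c, hc, rfl⟩ := List.mem_map.1 hz
        rcases mem_closedNbhd_xJoin.1 hyz' with h | ⟨h, h'⟩
        · exact (pathPower n m).irrefl h
        · exact hyz c hc h'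
    · rw [if_neg hkI] at hr
      have hb₁ : b₁ = [] := by
        cases b₁ with
        | nil => rfl
        | cons => simp at hr
      subst hb₁
      obtain ⟨j, -, hj⟩ := hex k (by simp) hkI
      -- The footprint of `w k` lies over `k + m`: earlier entries lie over some `t < k`, too far
      -- away to reach it. The later element `j` of `I` ensures that `k + m` is still on the path.
      obtain ⟨u, hu⟩ := exists_mem_add_eq hj
      refine ⟨⟨u, Classical.arbitrary _⟩, mem_closedNbhd_xJoin.2 (Or.inl (pathPower_adj.2
        ⟨fun h => ?_, by omega, by omega⟩)), fun z hz hyz => ?_⟩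
      · rw [h] at hu
        omega
      · rw [List.map_nil, List.append_nil] at hz
        obtain ⟨t, ht, hz⟩ := List.mem_flatMap.1 hz
        obtain ⟨c, -, rfl⟩ := List.mem_map.1 hz
        have h₁ := Fin.lt_def.1 (hT₁ t ht)
        rcases mem_closedNbhd_xJoin.1 hyz with h | ⟨h, -⟩
        · have := pathPower_adj.1 h
          omega
        · rw [h] at hu
          omega
  refine ⟨hfoot.nodup, ?_, hasFootprints_iff.1 hfoot⟩
  rintro ⟨v, a⟩
  have hmem : ∀ k ∈ pathSeq m I, ∃ c, (⟨k, c⟩ : Σ i, V i) ∈ substSeq I S w (pathSeq m I) := by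
    intro k hk
    have : ∃ c, c ∈ if k ∈ I then S k else [w k] := by
      split_ifs
      · obtain ⟨c, hc, -⟩ := (hS k).dominating (Classical.arbitrary _)
        exact ⟨c, hc⟩
      · exact ⟨w k, by simp⟩
    obtain ⟨c, hc⟩ := this
    exact ⟨c, List.mem_flatMap.2 ⟨k, hk, List.mem_map_of_mem hc⟩⟩
  by_cases hv : v ∈ I
  · obtain ⟨c, hc, hca⟩ := (hS v).dominating a
    refine ⟨⟨v, c⟩, List.mem_flatMap.2 ⟨v, hsub v hv, ?_⟩,
      mem_closedNbhd_xJoin.2 (Or.inr ⟨rfl, hca⟩)⟩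
    rw [if_pos hv]
    exact List.mem_map_of_mem hc
  · have : ∃ k ∈ pathSeq m I, k ≠ v ∧ (v : ℕ) ≤ k + m ∧ (k : ℕ) ≤ v + m := by
      have hmin := I.min'_mem hI
      have hmax := I.max'_mem hI
      rw [label] at hlo hhi
      rcases le_or_gt (I.min' hI) v with h₁ | h₁
      · rcases le_or_gt v (I.max' hI) with h₂ | h₂
        · exact hnear v ⟨_, hmin, h₁⟩ ⟨_, hmax, h₂⟩ hv
        · have := Fin.lt_def.1 h₂
          exact ⟨_, hsub _ hmax, h₂.ne, by omega, by omega⟩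
      · have := Fin.lt_def.1 h₁
        exact ⟨_, hsub _ hmin, h₁.ne', by omega, by omega⟩
    obtain ⟨k, hk, hkv, h₁, h₂⟩ := this
    obtain ⟨c, hc⟩ := hmem k hk
    exact ⟨_, hc, mem_closedNbhd_xJoin.2 (Or.inl (pathPower_adj.2 ⟨hkv.symm, h₂, h₁⟩))⟩

theorem length_substSeq {n m : ℕ} {V : Fin n → Type*} {H : ∀ i, SimpleGraph (V i)}
    {S : ∀ i, List (V i)} (hS : ∀ i, (S i).length = grundyNumber (H i)) (w : ∀ i, V i)
    {I : Finset (Fin n)} (hI : I.Nonempty) (hadm : Admissible n m I hI) :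
    ((substSeq I S w (pathSeq m I)).length : ℤ) = objective m H I hI + m + 1 := by
  have hp := pairwise_sort_of_isIndepSet hadm.1
  have hnd : (pathSeq m I).Nodup := (pairwise_lt_pathSeqAux _ hp).nodup
  have hsub : I ⊆ (pathSeq m I).toFinset := fun i hi =>
    List.mem_toFinset.2 (subset_pathSeqAux _ hp i ((I.mem_sort _).2 hi))
  have h₁ : ((substSeq I S w (pathSeq m I)).length : ℤ) =
      ∑ i ∈ (pathSeq m I).toFinset, (1 + if i ∈ I then (grundyNumber (H i) : ℤ) - 1 else 0) := by
    rw [List.sum_toFinset _ hnd, substSeq, List.length_flatMap, Nat.cast_list_sum, List.map_map]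
    refine congrArg _ (List.map_congr_left fun i _ => ?_)
    by_cases h : i ∈ I <;> simp [h, hS]
  rw [h₁, Finset.sum_add_distrib, Finset.sum_ite_mem, Finset.inter_eq_right.2 hsub,
    Finset.sum_const, List.toFinset_card_of_nodup hnd, nsmul_one, length_pathSeq hI hadm.1,
    objective, label, label]
  push_cast
  ring

/-! ### Upper bound: counting footprinted path vertices -/

/-- Let `p` be the first position with a footprint in the window. Then `π p` lies in the window too,
and every other footprinted vertex there is more than `m` away from `π p`. So some `m + 1`
consecutive vertices of the window contain no footprint except possibly `φ p`. -/
theorem card_window_le {ι : Type*} [Fintype ι] [LinearOrder ι] {n m : ℕ} {π φ : ι → Fin n}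
    (hadj : ∀ p, π p = φ p ∨ (pathPower n m).Adj (π p) (φ p))
    (hnadj : ∀ p q, p < q → ¬ (pathPower n m).Adj (π p) (φ q))
    (hne : ∀ p q, p < q → φ q ≠ φ p → φ q ≠ π p) {a c : Fin n}
    (ha : (a : ℕ) = 0 ∨ ∃ p, π p = a ∧ φ p = a) (hc : (c : ℕ) + 1 = n ∨ ∃ p, π p = c ∧ φ p = c)
    (hac : a ≤ c) :
    (Finset.univ.image φ ∩ Finset.Icc a c).card ≤ max 1 ((c : ℕ) + 1 - a - m) := by
  rcases (Finset.univ.filter fun p => φ p ∈ Finset.Icc a c).eq_empty_or_nonempty with h0 | h0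
  · have : Finset.univ.image φ ∩ Finset.Icc a c = ∅ := by
      refine Finset.eq_empty_of_forall_notMem fun u hu => ?_
      obtain ⟨hu, hu'⟩ := Finset.mem_inter.1 hu
      obtain ⟨p, -, rfl⟩ := Finset.mem_image.1 hu
      exact Finset.notMem_empty p (h0 ▸ Finset.mem_filter.2 ⟨Finset.mem_univ _, hu'⟩)
    simp [this]
  obtain ⟨p, hp, hmin⟩ := Finset.exists_min_image _ id h0
  simp only [Finset.mem_filter, Finset.mem_univ, true_and, id, Finset.mem_Icc, Fin.le_def]
    at hp hmin
  have hpd : (φ p : ℕ) ≤ π p + m ∧ (π p : ℕ) ≤ φ p + m := by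
    rcases hadj p with h | h
    · rw [h]; omega
    · exact (pathPower_adj.1 h).2
  have hac' := Fin.le_def.1 hac
  -- If `π p` were left of `a`, then `a`, lying between `π p` and `φ p`, would be adjacent to `π p`,
  -- so the later position `q` could not footprint `a`.
  have hpa : (a : ℕ) ≤ π p := by
    by_contra hlt
    rcases ha with ha | ⟨q, hq, hq'⟩
    · omega
    · have hpq : p ≠ q := fun h => by subst h; rw [hq] at hlt; exact hlt le_rfl
      refine hnadj p q (lt_of_le_of_ne (hmin q (by rw [hq']; exact ⟨le_rfl, hac'⟩)) hpq) ?_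
      rw [hq', pathPower_adj]
      exact ⟨fun h => hlt (by rw [h]), by omega, by omega⟩
  have hpc : (π p : ℕ) ≤ c := by
    by_contra hlt
    rcases hc with hc | ⟨q, hq, hq'⟩
    · omega
    · have hpq : p ≠ q := fun h => by subst h; rw [hq] at hlt; exact hlt le_rfl
      refine hnadj p q (lt_of_le_of_ne (hmin q (by rw [hq']; exact ⟨hac', le_rfl⟩)) hpq) ?_
      rw [hq', pathPower_adj]
      exact ⟨fun h => hlt (by rw [h]), by omega, by omega⟩
  have hsub : ∀ u ∈ Finset.univ.image φ ∩ Finset.Icc a c,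
      u = φ p ∨ (π p : ℕ) + m < u ∨ (u : ℕ) + m < π p := by
    intro u hu
    obtain ⟨hu, hu'⟩ := Finset.mem_inter.1 hu
    obtain ⟨q, -, rfl⟩ := Finset.mem_image.1 hu
    by_contra! h
    have hpq : p < q := lt_of_le_of_ne (hmin q (Finset.mem_Icc (α := Fin n) |>.1 hu'))
      fun e => h.1 (by rw [e])
    exact hnadj p q hpq (pathPower_adj.2 ⟨(hne p q hpq h.1).symm, h.2⟩)
  by_cases hm : (c : ℕ) ≤ a + m
  · refine le_max_of_le_left (Finset.card_le_one.2 ?_)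
    have h1 : ∀ u ∈ Finset.univ.image φ ∩ Finset.Icc a c, u = φ p := fun u hu => by
      have h2 := Finset.mem_Icc.1 (Finset.mem_inter.1 hu).2
      simp only [Fin.le_def] at h2
      rcases hsub u hu with h | h | h <;> [exact h; omega; omega]
    intro u hu v hv
    rw [h1 u hu, h1 v hv]
  · refine le_max_of_le_right ?_
    -- The block `s, …, s + m` starts at `π p`, shifted left just enough to end by `c`; all of it is
    -- within `m` of `π p`.
    obtain ⟨s, hs⟩ : ∃ s : Fin n, (s : ℕ) = min (π p : ℕ) (c - m) :=
      ⟨⟨min (π p) (c - m), by omega⟩, rfl⟩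
    obtain ⟨t, ht⟩ : ∃ t : Fin n, (t : ℕ) = s + m := ⟨⟨s + m, by omega⟩, rfl⟩
    have h1 : Finset.univ.image φ ∩ Finset.Icc a c ⊆
        insert (φ p) (Finset.Icc a c \ Finset.Icc s t) := by
      intro u hu
      have h2 := Finset.mem_Icc.1 (Finset.mem_inter.1 hu).2
      simp only [Finset.mem_insert, Finset.mem_sdiff, Finset.mem_Icc, Fin.le_def] at h2 ⊢
      rcases hsub u hu with h | h | h
      · exact Or.inl h
      · right; omega
      · right; omega
    have h2 : Finset.Icc s t ⊆ Finset.Icc a c := by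
      intro u hu
      simp only [Finset.mem_Icc, Fin.le_def] at hu ⊢
      omega
    have h3 := (Finset.card_le_card h1).trans (Finset.card_insert_le _ _)
    rw [Finset.card_sdiff_of_subset h2, Fin.card_Icc, Fin.card_Icc] at h3
    omega

theorem card_inter_Icc_add_one_le {n : ℕ} {F : Finset (Fin n)} {a b c : Fin n} (hb : b ∈ F)
    (hab : a ≤ b) (hbc : b ≤ c) :
    (F ∩ Finset.Icc a c).card + 1 ≤
      (F ∩ Finset.Icc a b).card + (F ∩ Finset.Icc b c).card := by
  rw [← Finset.card_union_add_card_inter]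
  refine add_le_add (Finset.card_le_card fun u hu => ?_) (Finset.card_pos.2 ⟨b, ?_⟩)
  · simp only [Finset.mem_inter, Finset.mem_union, Finset.mem_Icc] at hu ⊢
    rcases le_total u b with h | h
    · exact Or.inl ⟨hu.1, hu.2.1, h⟩
    · exact Or.inr ⟨hu.1, h, hu.2.2⟩
  · simp [hb, hab, hbc]

/-- Windows between consecutive elements of `B` are added up; each interior element of `B` belongs
to two of them, which is corrected by one. -/
theorem card_inter_Icc_min_max_le {n m : ℕ} {F : Finset (Fin n)} (B : Finset (Fin n))
    (hBF : B ⊆ F) (hind : ∀ i ∈ B, ∀ j ∈ B, i < j → (i : ℕ) + m < j)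
    (hw : ∀ a ∈ B, ∀ c ∈ B, a ≤ c →
      (F ∩ Finset.Icc a c).card ≤ max 1 ((c : ℕ) + 1 - a - m)) (hB : B.Nonempty) :
    ((F ∩ Finset.Icc (B.min' hB) (B.max' hB)).card : ℤ) ≤
      (B.max' hB : ℤ) - (B.min' hB : ℤ) - B.card * m + m + 1 := by
  induction B using Finset.induction_on_max with
  | empty => exact absurd hB Finset.not_nonempty_empty
  | insert a s has ih =>
    have has' : a ∉ s := fun h => lt_irrefl a (has a h)
    rcases s.eq_empty_or_nonempty with rfl | hs
    · have h := hw a (by simp) a (by simp) le_rfl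
      simp at h ⊢
      exact_mod_cast h.trans (by omega)
    · have ih := ih ((Finset.subset_insert _ _).trans hBF)
        (fun i hi j hj => hind i (Finset.mem_insert_of_mem hi) j (Finset.mem_insert_of_mem hj))
        (fun i hi j hj => hw i (Finset.mem_insert_of_mem hi) j (Finset.mem_insert_of_mem hj)) hs
      have hb := s.max'_mem hs
      have hba := has _ hb
      have hmin := s.min'_le_max' hs
      have hmax : (insert a s).max' hB = a := by
        rw [Finset.max'_insert _ _ hs]
        exact max_eq_left hba.le
      have hmin' : (insert a s).min' hB = s.min' hs := by
        rw [Finset.min'_insert _ _ hs]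
        exact min_eq_right (hmin.trans hba.le)
      have h1 := card_inter_Icc_add_one_le (hBF (Finset.mem_insert_of_mem hb)) hmin hba.le
      have h2 := hw _ (Finset.mem_insert_of_mem hb) a (Finset.mem_insert_self _ _) hba.le
      have h3 := hind _ (Finset.mem_insert_of_mem hb) a (Finset.mem_insert_self _ _) hba
      rw [hmax, hmin', Finset.card_insert_of_notMem has']
      rw [max_eq_right (by omega)] at h2
      push_cast
      rw [add_mul, one_mul]
      omega

/-- If `min B ≤ m`, the window from `o` to `min B` holds only `min B` and adds nothing. Otherwise
`o` is far enough away to join the independent set, and its window has the size of an interior one.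
-/
theorem exists_extend_left {n m : ℕ} {F B : Finset (Fin n)} (hBF : B ⊆ F)
    (hind : ∀ i ∈ B, ∀ j ∈ B, i < j → (i : ℕ) + m < j) {o : Fin n} (ho : (o : ℕ) = 0)
    (hw : ∀ a c, (a = o ∨ a ∈ B) → c ∈ B → a ≤ c →
      (F ∩ Finset.Icc a c).card ≤ max 1 ((c : ℕ) + 1 - a - m)) (hB : B.Nonempty) :
    ∃ (J : Finset (Fin n)) (hJ : J.Nonempty), B ⊆ J ∧
      (∀ i ∈ J, ∀ j ∈ J, i < j → (i : ℕ) + m < j) ∧ (J.min' hJ : ℕ) ≤ m ∧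
      J.max' hJ = B.max' hB ∧ ((F ∩ Finset.Icc o (J.max' hJ)).card : ℤ) ≤
        (J.max' hJ : ℤ) - (J.min' hJ : ℤ) - J.card * m + m + 1 := by
  have h1 := card_inter_Icc_min_max_le B hBF hind (fun a ha c => hw a c (Or.inr ha)) hB
  have hb := B.min'_mem hB
  have ho' : ∀ i : Fin n, o ≤ i := fun i => Fin.le_def.2 (by omega)
  have h2 := card_inter_Icc_add_one_le (hBF hb) (ho' _) (B.min'_le_max' hB)
  have h3 := hw o _ (Or.inl rfl) hb (ho' _)
  by_cases hm : (B.min' hB : ℕ) ≤ m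
  · refine ⟨B, hB, subset_rfl, hind, hm, rfl, ?_⟩
    omega
  · have hoB : o ∉ B := fun h => by
      have := Fin.le_def.1 (B.min'_le o h)
      omega
    have hmax : (insert o B).max' (Finset.insert_nonempty _ _) = B.max' hB := by
      rw [Finset.max'_insert _ _ hB]
      exact max_eq_right (ho' _)
    have hmin : (insert o B).min' (Finset.insert_nonempty _ _) = o := by
      rw [Finset.min'_insert _ _ hB]
      exact min_eq_left (ho' _)
    refine ⟨insert o B, Finset.insert_nonempty _ _, Finset.subset_insert _ _, ?_, ?_, hmax, ?_⟩
    · intro i hi j hj hij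
      rcases Finset.mem_insert.1 hj with rfl | hj'
      · exact absurd hij (ho' i).not_gt
      · rcases Finset.mem_insert.1 hi with rfl | hi'
        · have := Fin.le_def.1 (B.min'_le j hj')
          omega
        · exact hind i hi' j hj' hij
    · rw [hmin]
      omega
    · rw [hmax, hmin, Finset.card_insert_of_notMem hoB]
      push_cast
      rw [add_mul, one_mul]
      omega

theorem exists_admissible_card_le {n m : ℕ} (hmn : m + 2 ≤ n) {F B : Finset (Fin n)}
    (hBF : B ⊆ F) (hind : ∀ i ∈ B, ∀ j ∈ B, i < j → (i : ℕ) + m < j)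
    (hw : ∀ a c : Fin n, ((a : ℕ) = 0 ∨ a ∈ B) → ((c : ℕ) + 1 = n ∨ c ∈ B) → a ≤ c →
      (F ∩ Finset.Icc a c).card ≤ max 1 ((c : ℕ) + 1 - a - m)) :
    ∃ (I : Finset (Fin n)) (hI : I.Nonempty), B ⊆ I ∧ Admissible n m I hI ∧
      (F.card : ℤ) ≤ (I.max' hI : ℤ) - (I.min' hI : ℤ) - I.card * m + m + 1 := by
  obtain ⟨o, ho⟩ : ∃ o : Fin n, (o : ℕ) = 0 := ⟨⟨0, by omega⟩, rfl⟩
  obtain ⟨t, ht⟩ : ∃ t : Fin n, (t : ℕ) + 1 = n := ⟨⟨n - 1, by omega⟩, by simp only; omega⟩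
  have hot : o < t := Fin.lt_def.2 (by omega)
  have ht' : ∀ i : Fin n, i ≤ t := fun i => Fin.le_def.2 (by omega)
  have ho' : ∀ i : Fin n, o ≤ i := fun i => Fin.le_def.2 (by omega)
  have hF : F ∩ Finset.Icc o t = F :=
    Finset.inter_eq_left.2 fun u _ => Finset.mem_Icc.2 ⟨ho' u, ht' u⟩
  rcases B.eq_empty_or_nonempty with rfl | hB
  · have h1 := hw o t (Or.inl ho) (Or.inl ht) hot.le
    have hmax : ({o, t} : Finset (Fin n)).max' (Finset.insert_nonempty _ _) = t := by
      rw [Finset.max'_insert _ _ (Finset.singleton_nonempty t), Finset.max'_singleton]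
      exact max_eq_right hot.le
    have hmin : ({o, t} : Finset (Fin n)).min' (Finset.insert_nonempty _ _) = o := by
      rw [Finset.min'_insert _ _ (Finset.singleton_nonempty t), Finset.min'_singleton]
      exact min_eq_left hot.le
    refine ⟨{o, t}, Finset.insert_nonempty _ _, by simp, ⟨isIndepSet_pathPower_iff.2 ?_, ?_, ?_⟩,
      ?_⟩
    · intro i hi j hj hij
      simp only [Finset.mem_insert, Finset.mem_singleton] at hi hj
      have := Fin.lt_def.1 hij
      rcases hi with rfl | rfl <;> rcases hj with rfl | rfl <;> omega
    · rw [hmin, label]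
      omega
    · rw [hmax, label]
      omega
    · rw [hF] at h1
      rw [hmax, hmin, Finset.card_pair hot.ne]
      push_cast
      omega
  · obtain ⟨J, hJ, hBJ, hJind, hJmin, hJmax, hJF⟩ := exists_extend_left hBF hind ho
      (fun a c ha hc => hw a c (ha.imp_left fun h => by rw [h]; exact ho) (Or.inr hc)) hB
    have hb : J.max' hJ ∈ B := hJmax ▸ B.max'_mem hB
    have h2 := card_inter_Icc_add_one_le (hBF hb) (ho' _) (ht' _)
    have h3 := hw _ t (Or.inr hb) (Or.inl ht) (ht' _)
    rw [hF] at h2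
    by_cases hm : n ≤ (J.max' hJ : ℕ) + m + 1
    · refine ⟨J, hJ, hBJ, ⟨isIndepSet_pathPower_iff.2 hJind, ?_, ?_⟩, ?_⟩
      · rw [label]
        omega
      · rw [label]
        omega
      · omega
    · have htJ : t ∉ J := fun h => by
        have := Fin.le_def.1 (J.le_max' t h)
        omega
      have hmax : (insert t J).max' (Finset.insert_nonempty _ _) = t := by
        rw [Finset.max'_insert _ _ hJ]
        exact max_eq_left (ht' _)
      have hmin : (insert t J).min' (Finset.insert_nonempty _ _) = J.min' hJ := by
        rw [Finset.min'_insert _ _ hJ]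
        exact min_eq_right (ht' _)
      refine ⟨insert t J, Finset.insert_nonempty _ _, hBJ.trans (Finset.subset_insert _ _),
        ⟨isIndepSet_pathPower_iff.2 ?_, ?_, ?_⟩, ?_⟩
      · intro i hi j hj hij
        rcases Finset.mem_insert.1 hi with rfl | hi'
        · exact absurd hij (ht' j).not_gt
        · rcases Finset.mem_insert.1 hj with rfl | hj'
          · have := Fin.le_def.1 (J.le_max' i hi')
            omega
          · exact hJind i hi' j hj' hij
      · rw [hmin, label]
        omega
      · rw [hmax, label]
        omega
      · rw [hmax, hmin, Finset.card_insert_of_notMem htJ]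
        push_cast
        rw [add_mul, one_mul]
        omega

/-! ### Upper bound: footprints in the fibres -/

/-- The `i`-th component of a vertex lying over `i`, and an arbitrary vertex otherwise. -/
noncomputable def component {ι : Type*} {V : ι → Type*} [∀ i, Nonempty (V i)] (i : ι)
    (z : Σ i, V i) : V i :=
  open Classical in if h : z.1 = i then h ▸ z.2 else Classical.arbitrary _

theorem mem_closedNbhd_xJoin_component {ι : Type*} {G : SimpleGraph ι} {V : ι → Type*}
    [∀ i, Nonempty (V i)] {H : ∀ i, SimpleGraph (V i)} {i : ι} {x y : Σ i, V i}
    (hx : x.1 = i) (hy : y.1 = i) :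
    y ∈ closedNbhd (xJoin G H) x ↔ component i y ∈ closedNbhd (H i) (component i x) := by
  obtain ⟨j, b⟩ := y
  obtain ⟨k, a⟩ := x
  dsimp only at hx hy
  subst hx hy
  simp [mem_closedNbhd_xJoin, component]

/-- Entries over `i` project to `H i`. An entry outside the fibre that footprints into it dominates
the whole fibre, so it is the last position counted and may be replaced by its own footprint. -/
theorem card_fiber_le_grundyNumber {ι κ : Type*} [Fintype κ] [LinearOrder κ] [DecidableEq ι]
    {G : SimpleGraph ι} {V : ι → Type*} [∀ i, Finite (V i)] [∀ i, Nonempty (V i)]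
    {H : ∀ i, SimpleGraph (V i)} {x y : κ → Σ i, V i}
    (hxy : ∀ p, y p ∈ closedNbhd (xJoin G H) (x p))
    (hlt : ∀ p q, p < q → y q ∉ closedNbhd (xJoin G H) (x p)) (i : ι) :
    (Finset.univ.filter fun p => (y p).1 = i).card ≤ grundyNumber (H i) := by
  refine card_le_grundyNumber _ (fun p => if (x p).1 = i then component i (x p) else
    component i (y p)) (fun p => component i (y p)) ?_ ?_
  · intro p hp
    have hp := (Finset.mem_filter.1 hp).2
    split_ifs with h
    · exact (mem_closedNbhd_xJoin_component h hp).1 (hxy p)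
    · exact self_mem_closedNbhd _ _
  · intro p hp q hq hpq hmem
    have hp := (Finset.mem_filter.1 hp).2
    have hq := (Finset.mem_filter.1 hq).2
    split_ifs at hmem with h
    · exact hlt p q hpq ((mem_closedNbhd_xJoin_component h hq).2 hmem)
    · refine hlt p q hpq (mem_closedNbhd_xJoin.2 (Or.inl ?_))
      rw [hq, ← hp]
      rcases mem_closedNbhd_xJoin.1 (hxy p) with h' | ⟨h', -⟩
      · exact h'
      · exact absurd (h'.symm.trans hp) h

theorem exists_admissible_length_le {n m : ℕ} (hmn : m + 2 ≤ n) {V : Fin n → Type*}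
    [∀ i, Finite (V i)] [∀ i, Nonempty (V i)] {H : ∀ i, SimpleGraph (V i)} {T : List (Σ i, V i)}
    (hT : IsLegal (xJoin (pathPower n m) H) T) :
    ∃ (I : Finset (Fin n)) (hI : I.Nonempty), Admissible n m I hI ∧
      (T.length : ℤ) ≤ objective m H I hI + m + 1 := by
  -- Footprints are taken over the entry's own path vertex whenever possible; `hne` depends on this
  -- choice.
  have hy : ∀ p : Fin T.length, ∃ y ∈ privateNbhd (xJoin (pathPower n m) H) T p,
      (∃ y' ∈ privateNbhd (xJoin (pathPower n m) H) T p, y'.1 = (T.get p).1) →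
        y.1 = (T.get p).1 := by
    intro p
    by_cases h : ∃ y' ∈ privateNbhd (xJoin (pathPower n m) H) T p, y'.1 = (T.get p).1
    · obtain ⟨y, hy, hyp⟩ := h
      exact ⟨y, hy, fun _ => hyp⟩
    · obtain ⟨y, hy⟩ := hT.private_nonempty p
      exact ⟨y, hy, fun h' => absurd h' h⟩
  choose y hy hown using hy
  have hxy : ∀ p, y p ∈ closedNbhd (xJoin (pathPower n m) H) (T.get p) := fun p => (hy p).1
  have hlt : ∀ p q, p < q → y q ∉ closedNbhd (xJoin (pathPower n m) H) (T.get p) :=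
    fun p q hpq h => (hy q).2 (Set.mem_iUnion₂.2 ⟨p, hpq, h⟩)
  have hadj : ∀ p, (T.get p).1 = (y p).1 ∨ (pathPower n m).Adj (T.get p).1 (y p).1 := fun p =>
    (mem_closedNbhd_xJoin.1 (hxy p)).symm.imp_left fun h => h.1.symm
  have hnadj : ∀ p q, p < q → ¬ (pathPower n m).Adj (T.get p).1 (y q).1 := fun p q hpq h =>
    hlt p q hpq (mem_closedNbhd_xJoin.2 (Or.inl h))
  -- If `y q` lay over the path vertex of entry `p` but not over that of `y p`, entry `p` would have
  -- no footprint in its own fibre, so some earlier entry `r` dominates it. If `r` lies over a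
  -- neighbour, it dominates `y q`; if in the same fibre, it dominates `y p`. Both are impossible.
  have hne : ∀ p q, p < q → (y q).1 ≠ (y p).1 → (y q).1 ≠ (T.get p).1 := by
    intro p q hpq hqp hq
    have hp : ¬ (y p).1 = (T.get p).1 := fun h => hqp (hq.trans h.symm)
    have hx : T.get p ∉ privateNbhd (xJoin (pathPower n m) H) T p := fun h =>
      hp (hown p ⟨_, h, rfl⟩)
    have hx' : T.get p ∈ ⋃ j : Fin T.length, ⋃ _ : j < p,
        closedNbhd (xJoin (pathPower n m) H) (T.get j) := by
      by_contra h
      exact hx ⟨self_mem_closedNbhd _ _, h⟩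
    obtain ⟨r, hr, hmem⟩ := Set.mem_iUnion₂.1 hx'
    rcases mem_closedNbhd_xJoin.1 hmem with h | ⟨h, -⟩
    · exact hnadj r q (hr.trans hpq) (hq ▸ h)
    · exact hnadj r p hr (h ▸ (hadj p).resolve_left (Ne.symm hp))
  let F : Finset (Fin n) := Finset.univ.image fun p => (y p).1
  let B : Finset (Fin n) :=
    (Finset.univ.filter fun p => (T.get p).1 = (y p).1).image fun p => (y p).1
  have hB : ∀ i, i ∈ B ↔ ∃ p, (T.get p).1 = i ∧ (y p).1 = i := by
    intro i
    simp only [B, Finset.mem_image, Finset.mem_filter, Finset.mem_univ, true_and]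
    exact ⟨fun ⟨p, h, h'⟩ => ⟨p, h.trans h', h'⟩, fun ⟨p, h, h'⟩ => ⟨p, h.trans h'.symm, h'⟩⟩
  have hBF : B ⊆ F := Finset.image_subset_image (Finset.filter_subset _ _)
  have hind : ∀ i ∈ B, ∀ j ∈ B, i < j → (i : ℕ) + m < j := by
    intro i hi j hj hij
    obtain ⟨p, hp, hp'⟩ := (hB i).1 hi
    obtain ⟨q, hq, hq'⟩ := (hB j).1 hj
    have := Fin.lt_def.1 hij
    by_contra h
    have ha : (pathPower n m).Adj i j := pathPower_adj.2 ⟨hij.ne, by omega, by omega⟩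
    rcases lt_trichotomy p q with hpq | rfl | hpq
    · exact hnadj p q hpq (by rwa [hp, hq'])
    · exact hij.ne (hp.symm.trans hq)
    · exact hnadj q p hpq (by rw [hq, hp']; exact ha.symm)
  obtain ⟨I, hI, hBI, hadm, hF⟩ := exists_admissible_card_le hmn hBF hind fun a c ha hc hac =>
    card_window_le hadj hnadj hne (ha.imp_right (hB a).1) (hc.imp_right (hB c).1) hac
  refine ⟨I, hI, hadm, ?_⟩
  have hcard : T.length = ∑ i ∈ F, (Finset.univ.filter fun p => (y p).1 = i).card := by
    rw [← Finset.card_eq_sum_card_image, Finset.card_univ, Fintype.card_fin]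
  have hfib : ∀ i ∈ F, ((Finset.univ.filter fun p => (y p).1 = i).card : ℤ) ≤
      1 + if i ∈ B then (grundyNumber (H i) : ℤ) - 1 else 0 := by
    intro i _
    split_ifs with hi
    · have := card_fiber_le_grundyNumber hxy hlt i
      omega
    · have : (Finset.univ.filter fun p => (y p).1 = i).card ≤ 1 := by
        refine Finset.card_le_one.2 fun p hp q hq => ?_
        have hp := (Finset.mem_filter.1 hp).2
        have hq := (Finset.mem_filter.1 hq).2
        have key : ∀ p q, p < q → (y p).1 = i → (y q).1 ≠ i := fun p q hpq hp hq =>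
          hnadj p q hpq (hq.trans hp.symm ▸ (hadj p).resolve_left
            fun h => hi ((hB i).2 ⟨p, h.trans hp, hp⟩))
        rcases lt_trichotomy p q with h | h | h
        · exact absurd hq (key p q h hp)
        · exact h
        · exact absurd hp (key q p h hq)
      omega
  have hsum : (T.length : ℤ) ≤ F.card + ∑ i ∈ B, ((grundyNumber (H i) : ℤ) - 1) := by
    rw [hcard, Nat.cast_sum]
    refine (Finset.sum_le_sum hfib).trans_eq ?_
    rw [Finset.sum_add_distrib, Finset.sum_ite_mem, Finset.inter_eq_right.2 hBF,
      Finset.sum_const, nsmul_one]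
  -- Path ends added to `B` do no harm, as every summand is nonnegative.
  have hsumI : ∑ i ∈ B, ((grundyNumber (H i) : ℤ) - 1) ≤ ∑ i ∈ I, ((grundyNumber (H i) : ℤ) - 1) :=
    Finset.sum_le_sum_of_subset_of_nonneg hBI fun i _ _ => by
      have := one_le_grundyNumber (H i)
      omega
  rw [objective, label, label]
  push_cast
  linarith

end GrundyXJoin

/-! ### The main theorem -/

theorem mainTheorem6 (n m : ℕ) (hm : 1 ≤ m) (hmn : m + 2 ≤ n)
    (V : Fin n → Type*) [∀ i, Finite (V i)] [∀ i, Nonempty (V i)]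
    (H : ∀ i, SimpleGraph (V i)) :
    (∃ M : ℤ,
      IsGreatest
        {x : ℤ | ∃ (I : Finset (Fin n)) (hI : I.Nonempty),
          GrundyXJoin.Admissible n m I hI ∧ x = GrundyXJoin.objective m H I hI} M ∧
      (GrundyXJoin.grundyNumber (GrundyXJoin.xJoin (GrundyXJoin.pathPower n m) H) : ℤ)
        = M + (m : ℤ) + 1) ∧
    (∀ (S : ∀ i, List (V i)), (∀ i, GrundyXJoin.IsGds (H i) (S i)) →
      ∀ (w : ∀ i, V i) (I : Finset (Fin n)) (hI : I.Nonempty),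
        GrundyXJoin.Admissible n m I hI →
        GrundyXJoin.objective m H I hI + (m : ℤ) + 1
          = (GrundyXJoin.grundyNumber
              (GrundyXJoin.xJoin (GrundyXJoin.pathPower n m) H) : ℤ) →
        GrundyXJoin.IsGds (GrundyXJoin.xJoin (GrundyXJoin.pathPower n m) H)
          (GrundyXJoin.substSeq I S w (GrundyXJoin.pathSeq m I))) := by
  have upper : ∀ M : ℤ, (∀ (I : Finset (Fin n)) (hI : I.Nonempty),
      GrundyXJoin.Admissible n m I hI → GrundyXJoin.objective m H I hI ≤ M) →
      (GrundyXJoin.grundyNumber (GrundyXJoin.xJoin (GrundyXJoin.pathPower n m) H) : ℤ)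
        ≤ M + m + 1 := by
    intro M hM
    obtain ⟨T, hT, hl⟩ :=
      GrundyXJoin.exists_isLegal_length_eq (GrundyXJoin.xJoin (GrundyXJoin.pathPower n m) H)
    obtain ⟨I, hI, hadm, hle⟩ := GrundyXJoin.exists_admissible_length_le hmn hT
    have := hM I hI hadm
    omega
  constructor
  · obtain ⟨T, hT, -⟩ :=
      GrundyXJoin.exists_isLegal_length_eq (GrundyXJoin.xJoin (GrundyXJoin.pathPower n m) H)
    -- The upper bound, applied to any legal sequence, also shows that an admissible set exists, so
    -- the maximum is over a nonempty family.
    obtain ⟨I₀, hI₀, hadm₀, -⟩ := GrundyXJoin.exists_admissible_length_le hmn hT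
    have hfin : {x : ℤ | ∃ (I : Finset (Fin n)) (hI : I.Nonempty),
        GrundyXJoin.Admissible n m I hI ∧ x = GrundyXJoin.objective m H I hI}.Finite := by
      refine (Set.finite_range fun I : {I : Finset (Fin n) // I.Nonempty} =>
        GrundyXJoin.objective m H I.1 I.2).subset ?_
      rintro x ⟨I, hI, -, rfl⟩
      exact ⟨⟨I, hI⟩, rfl⟩
    obtain ⟨M, hM, hmax⟩ := Set.exists_max_image _ id hfin ⟨_, I₀, hI₀, hadm₀, rfl⟩
    refine ⟨M, ⟨hM, fun x hx => hmax x hx⟩, le_antisymm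
      (upper M fun I hI hadm => hmax _ ⟨I, hI, hadm, rfl⟩) ?_⟩
    obtain ⟨I, hI, hadm, rfl⟩ := hM
    choose S hS hl using fun i => GrundyXJoin.exists_isLegal_length_eq (H i)
    have w : ∀ i, V i := fun i => Classical.arbitrary _
    rw [← GrundyXJoin.length_substSeq hl w hI hadm, Nat.cast_le]
    exact (GrundyXJoin.isLegal_substSeq hm hS w hI hadm).length_le_grundyNumber
  · intro S hS w I hI hadm hopt
    simp only [GrundyXJoin.isGds_iff] at hS
    refine GrundyXJoin.isGds_iff.2
      ⟨GrundyXJoin.isLegal_substSeq hm (fun i => (hS i).1) w hI hadm, ?_⟩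
    have := GrundyXJoin.length_substSeq (fun i => (hS i).2) w hI hadm
    omega
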